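/- Let $G$ and $H$ be finitely generated free groups with free bases $g_1,\dots,g_n$ of $G$ ($n\ge 0$) and $h_1,\dots,h_m$ of $H$, where $m>1$. For homomorphisms $\phi,\psi\colon G\to H$ and $u\in H$, let $[u]$ denote the doubly-twisted conjugacy class of $u$, that is, the class of $u$ under the equivalence relation on $H$ in which $u$ and $v$ are equivalent if and only if $u=\phi(g)\,v\,\psi(g)^{-1}$ for some $g\in G$. For $p\in\mathbb N$ let $H_p$ be the finite set of elements of $H$ whose reduced word in $h_1^{\pm1},\dots,h_m^{\pm1}$ has length at most $p$. A set $S\subseteq H^l$ is called generic if it has asymptotic density $1$, that is, if $$\lim_{p\to\infty}\frac{|S\cap (H_p)^l|}{|(H_p)^l|}=1 .$$ Identify a tuple $(\phi,\psi,u,v)$, with $\phi,\psi\colon G\to H$ homomorphisms and $u,v\in H$, with the $(2n+2)$-tuple $(\phi(g_1),\dots,\phi(g_n),\psi(g_1),\dots,\psi(g_n),u,v)\in H^{2n+2}$. Then the set $$S=\{(\phi,\psi,u,v)\mid [u]\neq[v]\text{ with respect to }\phi,\psi\}$$ is generic, as a subset of $H^{2n+2}$. -/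

import Mathlib

open Filter Topology

/-- The relation `u = φ(g) v ψ(g)⁻¹` for some `g`, as an equivalence relation on `H`. -/
def doublyTwistedSetoid {G H : Type*} [Group G] [Group H] (φ ψ : G →* H) : Setoid H where
  r u v := ∃ g : G, u = φ g * v * (ψ g)⁻¹
  iseqv :=
    { refl := fun u => ⟨1, by simp⟩
      symm := by
        rintro u v ⟨g, rfl⟩
        exact ⟨g⁻¹, by simp [mul_assoc]⟩
      trans := by
        rintro u v w ⟨g, rfl⟩ ⟨k, rfl⟩
        exact ⟨g * k, by simp [mul_assoc]⟩ }

/-- The doubly-twisted conjugacy class `[u]` of `u` with respect to `φ` and `ψ`. -/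
def doublyTwistedClass {G H : Type*} [Group G] [Group H] (φ ψ : G →* H) (u : H) :
    Quotient (doublyTwistedSetoid φ ψ) :=
  Quotient.mk (doublyTwistedSetoid φ ψ) u

open Classical in
/-- The length of the reduced word in the basis `b` and its inverses that represents `h`. -/
noncomputable def wordLength {κ H : Type*} [Group H] (b : FreeGroupBasis κ H) (h : H) : ℕ :=
  (b.repr h).norm

/-- The tuples, indexed by `σ`, all of whose entries have word length at most `p`. -/
def tupleBall {κ H : Type*} [Group H] (b : FreeGroupBasis κ H) (σ : Type*) (p : ℕ) :
    Set (σ → H) :=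
  {x | ∀ i, wordLength b (x i) ≤ p}

/-- The set `S` of tuples of elements of `H`, indexed by `σ`, has asymptotic density `d`.
This is used for finite `σ` and finite bases only, where `tupleBall b σ p` is finite. -/
def HasAsymptoticDensity {κ H σ : Type*} [Group H] (b : FreeGroupBasis κ H)
    (S : Set (σ → H)) (d : ℝ) : Prop :=
  Tendsto
    (fun p : ℕ => ((S ∩ tupleBall b σ p).ncard : ℝ) / ((tupleBall b σ p).ncard : ℝ))
    atTop (𝓝 d)

/-- A set of tuples is generic if it has asymptotic density `1`. -/
def IsGeneric {κ H σ : Type*} [Group H] (b : FreeGroupBasis κ H) (S : Set (σ → H)) : Prop :=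
  HasAsymptoticDensity b S 1

/-- A pair of homomorphisms and a pair of elements `(φ, ψ, u, v)`, viewed as the tuple of
elements of `H` consisting of the images under `φ` of the basis of `G`, the images under `ψ` of
the basis of `G`, and `u` and `v`. -/
def homPairTuple {ι G H : Type*} [Group G] [Group H] (a : FreeGroupBasis ι G) :
    (G →* H) × (G →* H) × H × H ≃ (ι ⊕ ι ⊕ Fin 2 → H) where
  toFun x := Sum.elim (fun i => x.1 (a i)) (Sum.elim (fun i => x.2.1 (a i)) ![x.2.2.1, x.2.2.2])
  invFun y := (a.lift fun i => y (Sum.inl i), a.lift fun i => y (Sum.inr (Sum.inl i)),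
    y (Sum.inr (Sum.inr 0)), y (Sum.inr (Sum.inr 1)))
  left_inv := by
    rintro ⟨φ, ψ, u, v⟩
    refine Prod.ext (a.ext_hom _ _ fun i => ?_) (Prod.ext (a.ext_hom _ _ fun i => ?_) ?_) <;> simp
  right_inv := by
    intro y
    funext i
    rcases i with i | i | i
    · simp
    · simp
    · fin_cases i <;> simp

/-! A random tuple of k = 2n+2 elements freely generates a subgroup. An equation u = φ(g) v ψ(g)⁻¹
would then be a relation between free generators, which is impossible: the generator sent to u has
exponent sum 1 on the left and 0 on the right.

For genericity, put q = 2m-1 ≥ 3. If every entry has length at least 2L and the prefixes of length L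
of the entries and their inverses are distinct, ping-pong shows that the tuple is free
(`injective_lift_of_initial`). Since q^p ≤ |H_p| ≤ 2q^p, a short entry or a coincidence of two given
prefixes has proportion at most 4/q^L when 4L ≤ p. A union bound with L = p/4 finishes the proof
(`card_not_injective_lift_mul_le`). -/

namespace FreeGroup

/-! ### Cancellation and prefixes of reduced words -/

section Words

variable {α : Type*}

theorem IsReduced.exists_cancel {u v : List (α × Bool)} (hu : IsReduced u) (hv : IsReduced v) :
    ∃ u' c v', u = u' ++ invRev c ∧ v = c ++ v' ∧ IsReduced (u' ++ v') := by
  induction v generalizing u with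
  | nil => exact ⟨u, [], [], by simp, rfl, by simpa using hu⟩
  | cons b v ih =>
    rcases List.eq_nil_or_concat' u with rfl | ⟨u₀, a, rfl⟩
    · exact ⟨[], [], b :: v, by simp, rfl, hv⟩
    · by_cases hab : a.1 = b.1 → a.2 = b.2
      · refine ⟨u₀ ++ [a], [], b :: v, by simp, rfl, ?_⟩
        have h : IsReduced ([a] ++ b :: v) := isReduced_cons_cons.2 ⟨hab, hv⟩
        exact hu.append_overlap h (by simp)
      · have hu₀ : IsReduced u₀ := hu.infix ⟨[], [a], by simp⟩
        have hv₀ : IsReduced v := hv.infix ⟨[b], [], by simp⟩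
        obtain ⟨u', c, v', rfl, rfl, h⟩ := ih hu₀ hv₀
        refine ⟨u', b :: c, v', ?_, rfl, h⟩
        obtain ⟨a₁, a₂⟩ := a
        obtain ⟨b₁, b₂⟩ := b
        simp only [Classical.not_imp] at hab
        obtain ⟨rfl, hab⟩ := hab
        rw [invRev_cons, List.append_assoc]
        congr 2
        simpa [invRev] using Bool.eq_not_of_ne hab

variable [DecidableEq α]

theorem exists_toWord_mul (x y : FreeGroup α) :
    ∃ u c v, x.toWord = u ++ invRev c ∧ y.toWord = c ++ v ∧ (x * y).toWord = u ++ v := by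
  obtain ⟨u, c, v, hx, hy, h⟩ :=
    (isReduced_toWord (x := x)).exists_cancel (isReduced_toWord (x := y))
  refine ⟨u, c, v, hx, hy, ?_⟩
  have : x * y = mk (u ++ v) := by
    rw [← mk_toWord (x := x), ← mk_toWord (x := y), hx, hy, ← mul_mk, ← mul_mk, ← mul_mk,
      ← inv_mk]
    group
  rw [this, toWord_mk, h.reduce_eq]

/-- The prefix of length `L` of the reduced word of `x`. -/
def initial (L : ℕ) (x : FreeGroup α) : List (α × Bool) := x.toWord.take L

/-- If `y` does not start like `x⁻¹`, then `x * y` starts like `x`. -/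
theorem initial_mul {L : ℕ} {x y : FreeGroup α} (hx : 2 * L ≤ norm x)
    (h : initial L y ≠ initial L x⁻¹) : initial L (x * y) = initial L x := by
  obtain ⟨u, c, v, hxw, hyw, hm⟩ := exists_toWord_mul x y
  have hlen : norm x = u.length + c.length := by simp [norm, hxw]
  -- The cancelled part `c` is a common prefix of `y` and `x⁻¹`, so it is shorter than `L`; at least
  -- half of `x` survives.
  have hc : c.length < L := by
    by_contra! hc
    apply h
    simp only [initial]
    rw [toWord_inv, hxw, hyw, invRev_append, invRev_invRev, List.take_append_of_le_length hc,
      List.take_append_of_le_length hc]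
  have hu : L ≤ u.length := by omega
  simp only [initial]
  rw [hm, hxw, List.take_append_of_le_length hu, List.take_append_of_le_length hu]

theorem norm_initial_inv_mul (L : ℕ) (x : FreeGroup α) :
    norm ((mk (initial L x))⁻¹ * x) ≤ norm x - L := by
  have : (mk (initial L x))⁻¹ * x = mk (x.toWord.drop L) := by
    rw [inv_mul_eq_iff_eq_mul, initial, mul_mk, List.take_append_drop, mk_toWord]
  rw [this]
  exact norm_mk_le.trans (by simp [norm])

theorem norm_mk_initial_le (L : ℕ) (x : FreeGroup α) : norm (mk (initial L x)) ≤ L :=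
  norm_mk_le.trans (by simp [initial])

/-- An element whose reduced word starts with `w` and ends with `w⁻¹` becomes shorter by
`2 * w.length` when it is conjugated by `w`. -/
theorem norm_initial_conj {L : ℕ} {x : FreeGroup α} (hx : 2 * L ≤ norm x)
    (h : initial L x = initial L x⁻¹) :
    norm ((mk (initial L x))⁻¹ * x * mk (initial L x)) ≤ norm x - 2 * L := by
  -- As `x` has length at least `2 * L`, its prefix `w` and its suffix `w⁻¹` do not overlap, so
  -- `w⁻¹` lies inside `z`.
  set z := x.toWord.drop L with hz
  have hx' : x.toWord = x.toWord.take L ++ z := by simp [hz]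
  have hzL : L ≤ z.length := by
    have : z.length = norm x - L := by simp [hz, norm]
    omega
  have hw : initial L x = (invRev z).take L := by
    rw [h, initial, toWord_inv, hx', invRev_append, List.take_append_of_le_length]
    simpa using hzL
  have hz' : z = invRev ((invRev z).drop L) ++ invRev (initial L x) := by
    rw [hw, ← invRev_append, List.take_append_drop, invRev_invRev]
  have : (mk (initial L x))⁻¹ * x * mk (initial L x) = mk (invRev ((invRev z).drop L)) := by
    have h1 : x = mk (initial L x) * mk z := by
      rw [initial, mul_mk, ← hx', mk_toWord]
    have h2 : mk z = mk (invRev ((invRev z).drop L)) * (mk (initial L x))⁻¹ := by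
      rw [inv_mk, mul_mk, ← hz']
    rw [h2, ← mul_assoc, ← mul_inv_eq_iff_eq_mul, inv_inv] at h1
    rw [mul_assoc, h1, inv_mul_cancel_left]
  rw [this]
  refine norm_mk_le.trans ?_
  simp only [invRev_length, List.length_drop, hz, norm]
  omega

end Words

/-! ### Free tuples by ping-pong -/

section PingPong

variable {α σ : Type*} [DecidableEq α]

/-- The entries of the tuple `x` and their inverses. -/
def signedEntry (x : σ → FreeGroup α) (s : σ × Bool) : FreeGroup α :=
  if s.2 then x s.1 else (x s.1)⁻¹

theorem norm_signedEntry (x : σ → FreeGroup α) (s : σ × Bool) :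
    norm (signedEntry x s) = norm (x s.1) := by
  unfold signedEntry
  split_ifs <;> simp

/-- Ping-pong on the cylinders `Z s` of elements that start like `signedEntry x s`: by
`initial_mul`, each signed entry maps the complement of its inverse's cylinder into its own. -/
theorem injective_lift_of_initial [Nontrivial σ] {x : σ → FreeGroup α} {L : ℕ}
    (hx : ∀ i, 2 * L ≤ norm (x i))
    (h : Function.Injective fun s => initial L (signedEntry x s)) :
    Function.Injective (lift x) := by
  have hinj : Function.Injective x := fun i j hij => by
    simpa using h (a₁ := (i, true)) (a₂ := (j, true)) (by simp [signedEntry, hij])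
  -- the range of `x` replaces `σ`, because the ping-pong lemma fixes the universe
  let e := Equiv.ofInjective x hinj
  have hnt : Nontrivial (Set.range x) := e.symm.nontrivial
  let Z (s : σ × Bool) : Set (FreeGroup α) := {y | initial L y = initial L (signedEntry x s)}
  have hZ {s t : σ × Bool} (hst : s ≠ t) : Disjoint (Z s) (Z t) :=
    Set.disjoint_left.2 fun y hs ht => hst (h (hs.symm.trans ht))
  have hxe (r : Set.range x) : x (e.symm r) = r := Equiv.apply_ofInjective_symm hinj r
  have key : Function.Injective (lift fun r : Set.range x => (r : FreeGroup α)) := by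
    refine injective_lift_of_ping_pong _ (fun r => Z (e.symm r, true))
      (fun r => Z (e.symm r, false)) (fun r => ⟨x (e.symm r), rfl⟩)
      (fun i j hij => hZ (by simpa using hij)) (fun i j hij => hZ (by simpa using hij))
      (fun i j => hZ (by simp)) ?_ ?_
    · rintro r _ ⟨y, hy, rfl⟩
      simp only [← hxe r]
      exact initial_mul (hx _) hy
    · rintro r _ ⟨y, hy, rfl⟩
      simp only [Pi.inv_apply, ← hxe r]
      refine initial_mul (x := (x (e.symm r))⁻¹) (by simpa using hx _) ?_
      simpa [Z, signedEntry] using hy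
  have hcomp : lift x = (lift fun r : Set.range x => (r : FreeGroup α)).comp
      (freeGroupCongr e).toMonoidHom := by
    ext i
    simp [e]
  rw [hcomp]
  exact key.comp (freeGroupCongr e).injective

end PingPong

/-! ### Growth of balls in a free group -/

section Balls

variable {α : Type*} [DecidableEq α]

theorem finite_norm_le [Finite α] (p : ℕ) : {x : FreeGroup α | norm x ≤ p}.Finite :=
  (List.finite_length_le (α × Bool) p).preimage toWord_injective.injOn

/-- The ball of radius `p` around `1`. -/
noncomputable def normBall (α : Type*) [DecidableEq α] [Finite α] (p : ℕ) :
    Finset (FreeGroup α) :=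
  (finite_norm_le p).toFinset

@[simp]
theorem mem_normBall [Finite α] {p : ℕ} {x : FreeGroup α} : x ∈ normBall α p ↔ norm x ≤ p := by
  simp [normBall]

variable [Fintype α]

/-- The words of length `n` that can be appended to the letter `a` to give a reduced word. -/
def reducedTails : ℕ → α × Bool → Finset (List (α × Bool))
  | 0, _ => {[]}
  | n + 1, a => (Finset.univ.filter fun b : α × Bool => a.1 = b.1 → a.2 = b.2).biUnion
      fun b => (reducedTails n b).image (List.cons b)

theorem mem_reducedTails {n : ℕ} {a : α × Bool} {l : List (α × Bool)} :
    l ∈ reducedTails n a ↔ l.length = n ∧ IsReduced (a :: l) := by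
  induction n generalizing a l with
  | zero =>
    simp only [reducedTails, Finset.mem_singleton, List.length_eq_zero_iff]
    exact ⟨fun h => ⟨h, h ▸ IsReduced.singleton⟩, fun h => h.1⟩
  | succ n ih =>
    cases l with
    | nil => simp [reducedTails]
    | cons b l =>
      simp [reducedTails, isReduced_cons_cons, ih]
      tauto

omit [Fintype α] in
theorem card_biUnion_cons (s : Finset (α × Bool)) (f : α × Bool → Finset (List (α × Bool)))
    {c : ℕ} (hf : ∀ b, (f b).card = c) :
    (s.biUnion fun b => (f b).image (List.cons b)).card = s.card * c := by
  rw [Finset.card_biUnion]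
  · rw [Finset.sum_congr rfl fun b _ =>
      (Finset.card_image_of_injective _ List.cons_injective).trans (hf b)]
    simp
  · intro b _ b' _ hb
    rw [Function.onFun, Finset.disjoint_left]
    simp only [Finset.mem_image]
    rintro _ ⟨l, _, rfl⟩ ⟨l', _, h⟩
    exact hb (List.cons.inj h).1.symm

theorem card_reducedTails (n : ℕ) (a : α × Bool) :
    (reducedTails n a).card = (2 * Fintype.card α - 1) ^ n := by
  induction n generalizing a with
  | zero => simp [reducedTails]
  | succ n ih =>
    rw [reducedTails, card_biUnion_cons _ _ ih, pow_succ']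
    congr 1
    have : (Finset.univ.filter fun b : α × Bool => a.1 = b.1 → a.2 = b.2) =
        Finset.univ.erase (a.1, !a.2) := by
      ext ⟨b₁, b₂⟩
      simp only [Finset.mem_filter, Finset.mem_univ, true_and, Finset.mem_erase, ne_eq,
        Prod.mk.injEq, and_true]
      cases b₂ <;> cases a.2 <;> simp [eq_comm]
    rw [this, Finset.card_erase_of_mem (Finset.mem_univ _)]
    simp [mul_comm]

theorem card_normBall_succ (p : ℕ) :
    (normBall α (p + 1)).card =
      (normBall α p).card + 2 * Fintype.card α * (2 * Fintype.card α - 1) ^ p := by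
  rw [← Finset.card_filter_add_card_filter_not (s := normBall α (p + 1)) (fun x => norm x ≤ p)]
  congr 1
  · congr 1
    ext x
    simp only [Finset.mem_filter, mem_normBall]
    omega
  · rw [← Finset.card_image_of_injective _ toWord_injective]
    have := card_biUnion_cons Finset.univ _ (card_reducedTails (α := α) p)
    rw [Finset.card_univ, Fintype.card_prod, Fintype.card_bool, mul_comm (Fintype.card α)] at this
    rw [← this]
    congr 1
    ext l
    simp only [Finset.mem_image, Finset.mem_filter, mem_normBall, Finset.mem_biUnion,
      Finset.mem_univ, true_and, mem_reducedTails]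
    constructor
    · rintro ⟨x, ⟨h1, h2⟩, rfl⟩
      have hx : x.toWord.length = p + 1 := by
        simp only [norm] at h1 h2
        omega
      obtain ⟨a, l, hl⟩ := List.exists_of_length_succ _ hx
      refine ⟨a, l, ⟨by simpa [hl] using hx, ?_⟩, hl.symm⟩
      rw [← hl]
      exact isReduced_toWord
    · rintro ⟨a, l, ⟨h1, h2⟩, rfl⟩
      refine ⟨mk (a :: l), ?_, ?_⟩
      · simp [norm, h2.reduce_eq, h1]
      · rw [toWord_mk, h2.reduce_eq]

theorem pow_le_card_normBall (hα : 1 < Fintype.card α) (p : ℕ) :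
    (2 * Fintype.card α - 1) ^ p ≤ (normBall α p).card := by
  cases p with
  | zero =>
    rw [pow_zero, Nat.one_le_iff_ne_zero, Finset.card_ne_zero]
    exact ⟨1, by simp⟩
  | succ p =>
    rw [card_normBall_succ, pow_succ']
    exact le_add_left (Nat.mul_le_mul_right _ (by omega))

theorem card_normBall_le (hα : 1 < Fintype.card α) (p : ℕ) :
    (normBall α p).card ≤ 2 * (2 * Fintype.card α - 1) ^ p := by
  induction p with
  | zero =>
    have : normBall α 0 = {1} := by ext; simp
    simp [this]
  | succ p ih =>
    rw [card_normBall_succ, pow_succ']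
    -- With base b = q + 3, the induction step is 2b^p + (b+1)b^p ≤ 2b^(p+1), which holds because b
    -- ≥ 3.
    obtain ⟨q, hq⟩ : ∃ q, 2 * Fintype.card α = q + 4 := ⟨2 * Fintype.card α - 4, by omega⟩
    rw [hq] at ih ⊢
    simp only [Nat.add_succ_sub_one] at ih ⊢
    nlinarith [Nat.zero_le ((q + 3) ^ p), Nat.zero_le (q * (q + 3) ^ p)]

end Balls

end FreeGroup

namespace FreeGroup

/-! ### Counting tuples that are not free -/

section Tuples

variable {α σ : Type*} [DecidableEq α] [Fintype α] [DecidableEq σ] [Fintype σ]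

/-- The tuples all of whose entries have norm at most `p`. -/
noncomputable def normBox (α σ : Type*) [DecidableEq α] [Finite α] [DecidableEq σ] [Fintype σ]
    (p : ℕ) : Finset (σ → FreeGroup α) :=
  Fintype.piFinset fun _ => normBall α p

/-- The tuples in `normBox α σ p` with the entry at `j` ranging over `A` instead. -/
noncomputable def normBoxUpdate (σ : Type*) [DecidableEq σ] [Fintype σ] (p : ℕ) (j : σ)
    (A : Finset (FreeGroup α)) : Finset (σ → FreeGroup α) :=
  Fintype.piFinset (Function.update (fun _ => normBall α p) j A)

theorem mem_normBox {p : ℕ} {x : σ → FreeGroup α} : x ∈ normBox α σ p ↔ ∀ i, norm (x i) ≤ p := by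
  simp [normBox]

theorem mem_normBoxUpdate_of_mem {p : ℕ} {x : σ → FreeGroup α} {j : σ}
    {A : Finset (FreeGroup α)} (hx : x ∈ normBox α σ p) {y : FreeGroup α} (hy : y ∈ A) :
    Function.update x j y ∈ normBoxUpdate σ p j A := by
  rw [normBoxUpdate, Fintype.mem_piFinset]
  intro i
  rcases eq_or_ne i j with rfl | h
  · simpa using hy
  · simpa [h] using mem_normBox.1 hx i

theorem card_normBoxUpdate (p : ℕ) (j : σ) (A : Finset (FreeGroup α)) :
    (normBoxUpdate σ p j A).card * (normBall α p).card = A.card * (normBox α σ p).card := by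
  rw [normBoxUpdate, normBox, Fintype.card_piFinset, Fintype.card_piFinset,
    ← Finset.mul_prod_erase Finset.univ _ (Finset.mem_univ j), Function.update_self,
    ← Finset.mul_prod_erase Finset.univ (fun _ => (normBall α p).card) (Finset.mem_univ j),
    Finset.prod_congr rfl (g := fun _ => (normBall α p).card)
      fun i hi => by rw [Function.update_of_ne (Finset.ne_of_mem_erase hi)]]
  ring

/-- Reduces a density bound for tuples to one for a single coordinate. Comparing cardinalities,
rather than assuming an inclusion, allows `E` to be re-encoded injectively. -/
theorem card_mul_le_of_card_le_normBoxUpdate {p c C : ℕ} {j : σ} {A : Finset (FreeGroup α)}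
    {E : Finset (σ → FreeGroup α)} (hA : A.card * c ≤ C * (normBall α p).card)
    (hE : E.card ≤ (normBoxUpdate σ p j A).card) : E.card * c ≤ C * (normBox α σ p).card := by
  have hB : 0 < (normBall α p).card := Finset.card_pos.2 ⟨1, by simp⟩
  refine Nat.le_of_mul_le_mul_right ?_ hB
  calc E.card * c * (normBall α p).card
      ≤ (normBoxUpdate σ p j A).card * c * (normBall α p).card := by gcongr
    _ = A.card * c * (normBox α σ p).card := by
      rw [mul_right_comm, card_normBoxUpdate]
      ring
    _ ≤ C * (normBall α p).card * (normBox α σ p).card := by gcongr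
    _ = _ := by ring

theorem card_norm_lt_mul_le (hα : 1 < Fintype.card α) {L p : ℕ} (hp : 4 * L ≤ p) (j : σ) :
    ((normBox α σ p).filter fun x => norm (x j) < 2 * L).card * (2 * Fintype.card α - 1) ^ L ≤
      4 * (normBox α σ p).card := by
  refine card_mul_le_of_card_le_normBoxUpdate (j := j) (A := normBall α (2 * L)) ?_
    (Finset.card_le_card fun x hx => ?_)
  · set q := 2 * Fintype.card α - 1 with hq
    calc (normBall α (2 * L)).card * q ^ L ≤ 2 * q ^ (2 * L) * q ^ L := by
          gcongr
          exact card_normBall_le hα _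
      _ = 2 * q ^ (3 * L) := by ring
      _ ≤ 2 * q ^ p := by
          gcongr
          · omega
          · omega
      _ ≤ 4 * (normBall α p).card := by
          have : q ^ p ≤ _ := pow_le_card_normBall hα p
          omega
  · rw [Finset.mem_filter] at hx
    rw [← Function.update_eq_self j x]
    exact mem_normBoxUpdate_of_mem hx.1 (by simpa using hx.2.le)

/-- The tuples of long elements such that the entries at `s` and `t` have a long common prefix. -/
noncomputable def overlapBox (L p : ℕ) (s t : σ × Bool) : Finset (σ → FreeGroup α) :=
  (normBox α σ p).filter fun x => (∀ i, 2 * L ≤ norm (x i)) ∧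
    initial L (signedEntry x s) = initial L (signedEntry x t)

theorem card_overlapBox_self_mul_le (hα : 1 < Fintype.card α) {L p : ℕ} (hp : 4 * L ≤ p)
    {s t : σ × Bool} (hst : s ≠ t) (h : s.1 = t.1) :
    (overlapBox (α := α) L p s t).card * (2 * Fintype.card α - 1) ^ L ≤
      4 * (normBox α σ p).card := by
  -- An overlap of `x s.1` with its inverse makes it `w * z * w⁻¹` with `w` of length at most `L`
  -- and `z` of length at most `p - 2 * L`, leaving at most 4q^(p-L) choices.
  let A : Finset (FreeGroup α) :=
    (normBall α L ×ˢ normBall α (p - 2 * L)).image fun z => z.1 * z.2 * z.1⁻¹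
  refine card_mul_le_of_card_le_normBoxUpdate (j := s.1) (A := A) ?_
    (Finset.card_le_card fun x hx => ?_)
  · set q := 2 * Fintype.card α - 1 with hq
    calc A.card * q ^ L
        ≤ (normBall α L).card * (normBall α (p - 2 * L)).card * q ^ L := by
          gcongr
          exact Finset.card_image_le.trans (Finset.card_product _ _).le
      _ ≤ (2 * q ^ L) * (2 * q ^ (p - 2 * L)) * q ^ L := by
          gcongr <;> exact card_normBall_le hα _
      _ = 4 * q ^ (L + (p - 2 * L) + L) := by ring
      _ = 4 * q ^ p := by
          congr 2
          omega
      _ ≤ 4 * (normBall α p).card := by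
          gcongr
          exact pow_le_card_normBall hα p
  · simp only [overlapBox, Finset.mem_filter] at hx
    obtain ⟨hx, hlong, hov⟩ := hx
    have hov' : initial L (x s.1) = initial L (x s.1)⁻¹ := by
      obtain ⟨i, e⟩ := s
      obtain ⟨j, d⟩ := t
      obtain rfl : i = j := h
      cases e <;> cases d <;> simp_all [signedEntry]
    rw [← Function.update_eq_self s.1 x]
    refine mem_normBoxUpdate_of_mem hx (Finset.mem_image.2
      ⟨(mk (initial L (x s.1)), (mk (initial L (x s.1)))⁻¹ * x s.1 * mk (initial L (x s.1))),
        ?_, by group⟩)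
    rw [Finset.mem_product, mem_normBall, mem_normBall]
    exact ⟨norm_mk_initial_le _ _, (norm_initial_conj (hlong _) hov').trans
      (Nat.sub_le_sub_right (mem_normBox.1 hx _) _)⟩

theorem card_overlapBox_ne_mul_le (hα : 1 < Fintype.card α) {L p : ℕ} (hp : 4 * L ≤ p)
    {s t : σ × Bool} (h : s.1 ≠ t.1) :
    (overlapBox (α := α) L p s t).card * (2 * Fintype.card α - 1) ^ L ≤
      4 * (normBox α σ p).card := by
  refine card_mul_le_of_card_le_normBoxUpdate (j := t.1) (A := normBall α (p - L)) ?_ ?_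
  · set q := 2 * Fintype.card α - 1 with hq
    calc (normBall α (p - L)).card * q ^ L ≤ 2 * q ^ (p - L) * q ^ L := by
          gcongr
          exact card_normBall_le hα _
      _ = 2 * q ^ p := by
          rw [mul_assoc, ← pow_add]
          congr 2
          omega
      _ ≤ 4 * (normBall α p).card := by
          have : q ^ p ≤ _ := pow_le_card_normBall hα p
          omega
  -- Stripping the shared prefix from the entry at `t` loses nothing: the prefix can be read off the
  -- entry at `s`, which is unchanged since `s.1 ≠ t.1`.
  · refine Finset.card_le_card_of_injOn (fun x => Function.update x t.1
      ((mk (initial L (signedEntry x s)))⁻¹ * signedEntry x t)) (fun x hx => ?_) ?_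
    · simp only [overlapBox, Finset.coe_filter, Set.mem_ofPred_eq] at hx
      refine mem_normBoxUpdate_of_mem hx.1 ?_
      rw [mem_normBall, hx.2.2]
      refine (norm_initial_inv_mul _ _).trans ?_
      rw [norm_signedEntry]
      exact Nat.sub_le_sub_right (mem_normBox.1 hx.1 _) _
    · intro x _ y _ hxy
      have hne (i : σ) (hi : i ≠ t.1) : x i = y i := by
        simpa [hi] using congr_fun hxy i
      have hs : signedEntry x s = signedEntry y s := by
        simp [signedEntry, hne _ h]
      have ht : signedEntry x t = signedEntry y t := by
        simpa [hs] using congr_fun hxy t.1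
      have ht' : x t.1 = y t.1 := by
        unfold signedEntry at ht
        split_ifs at ht
        · exact ht
        · exact inv_injective ht
      funext i
      by_cases hi : i = t.1
      · exact hi ▸ ht'
      · exact hne i hi

open Classical in
-- Union bound with weight 4 for each of the k short-entry events and each of at most (2k)² ordered
-- pairs of signed indices.
theorem card_not_injective_lift_mul_le [Nontrivial σ] (hα : 1 < Fintype.card α) {L p : ℕ}
    (hp : 4 * L ≤ p) :
    ((normBox α σ p).filter fun x => ¬ Function.Injective (lift x)).card *
        (2 * Fintype.card α - 1) ^ L ≤
      (4 * Fintype.card σ + 16 * Fintype.card σ ^ 2) * (normBox α σ p).card := by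
  set c := (2 * Fintype.card α - 1) ^ L
  set N := (normBox α σ p).card
  set E₁ : σ → Finset (σ → FreeGroup α) :=
    fun j => (normBox α σ p).filter fun x => norm (x j) < 2 * L
  set P : Finset ((σ × Bool) × (σ × Bool)) := Finset.univ.filter fun r => r.1 ≠ r.2
  have hsub : ((normBox α σ p).filter fun x => ¬ Function.Injective (lift x)) ⊆
      (Finset.univ.biUnion E₁) ∪ P.biUnion fun r => overlapBox L p r.1 r.2 := by
    intro x hx
    rw [Finset.mem_filter] at hx
    rw [Finset.mem_union]
    by_cases hlong : ∀ i, 2 * L ≤ norm (x i)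
    · right
      have := mt (injective_lift_of_initial (L := L) hlong) hx.2
      simp only [Function.Injective, not_forall] at this
      obtain ⟨s, t, hov, hst⟩ := this
      refine Finset.mem_biUnion.2 ⟨(s, t), by simpa [P] using hst, ?_⟩
      exact Finset.mem_filter.2 ⟨hx.1, hlong, hov⟩
    · left
      push Not at hlong
      obtain ⟨i, hi⟩ := hlong
      exact Finset.mem_biUnion.2 ⟨i, Finset.mem_univ _, Finset.mem_filter.2 ⟨hx.1, hi⟩⟩
  have h₁ : (Finset.univ.biUnion E₁).card * c ≤ Fintype.card σ * (4 * N) := by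
    calc _ ≤ (∑ j, (E₁ j).card) * c := by
          gcongr
          exact Finset.card_biUnion_le
      _ = ∑ j, (E₁ j).card * c := Finset.sum_mul _ _ _
      _ ≤ ∑ _j : σ, 4 * N := Finset.sum_le_sum fun j _ => card_norm_lt_mul_le hα hp j
      _ = _ := by simp
  have h₂ : (P.biUnion fun r => overlapBox (α := α) L p r.1 r.2).card * c ≤
      (Fintype.card σ * 2) * (Fintype.card σ * 2) * (4 * N) := by
    calc _ ≤ (∑ r ∈ P, (overlapBox (α := α) L p r.1 r.2).card) * c := by
          gcongr
          exact Finset.card_biUnion_le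
      _ = ∑ r ∈ P, (overlapBox (α := α) L p r.1 r.2).card * c := Finset.sum_mul _ _ _
      _ ≤ ∑ _r ∈ P, 4 * N := by
          refine Finset.sum_le_sum fun r hr => ?_
          have hr : r.1 ≠ r.2 := by simpa [P] using hr
          by_cases h : r.1.1 = r.2.1
          · exact card_overlapBox_self_mul_le hα hp hr h
          · exact card_overlapBox_ne_mul_le hα hp h
      _ = P.card * (4 * N) := by simp
      _ ≤ _ := by
          gcongr
          refine (Finset.card_le_univ _).trans ?_
          simp
  calc _ ≤ ((Finset.univ.biUnion E₁).card +
        (P.biUnion fun r => overlapBox (α := α) L p r.1 r.2).card) * c := by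
        gcongr
        exact (Finset.card_le_card hsub).trans (Finset.card_union_le _ _)
    _ ≤ Fintype.card σ * (4 * N) +
        (Fintype.card σ * 2) * (Fintype.card σ * 2) * (4 * N) := by
        rw [add_mul]
        exact add_le_add h₁ h₂
    _ = _ := by ring

end Tuples

end FreeGroup

/-! ### Passage to asymptotic density -/

section Generic

variable {κ H σ : Type*} [Group H]

theorem finite_tupleBall [Finite κ] [Finite σ] (b : FreeGroupBasis κ H) (p : ℕ) :
    (tupleBall b σ p).Finite := by
  classical
  have : tupleBall b σ p = Set.univ.pi fun _ => b.repr ⁻¹' {x | FreeGroup.norm x ≤ p} := by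
    ext x
    simp only [tupleBall, wordLength, Set.mem_ofPred_eq, Set.mem_univ_pi, Set.mem_preimage]
  rw [this]
  exact Set.Finite.pi fun _ => (FreeGroup.finite_norm_le p).preimage b.repr.injective.injOn

theorem ncard_tupleBall_pos [Finite κ] [Finite σ] (b : FreeGroupBasis κ H) (p : ℕ) :
    0 < (tupleBall b σ p).ncard :=
  (Set.ncard_pos (finite_tupleBall b p)).2 ⟨1, fun i => by simp [wordLength]⟩

theorem IsGeneric.mono [Finite κ] [Finite σ] {b : FreeGroupBasis κ H} {S T : Set (σ → H)}
    (hS : IsGeneric b S) (hST : S ⊆ T) : IsGeneric b T := by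
  refine tendsto_of_tendsto_of_tendsto_of_le_of_le hS tendsto_const_nhds (fun p => ?_)
    fun p => ?_
  · have := Set.ncard_le_ncard (Set.inter_subset_inter_left (tupleBall b σ p) hST)
      ((finite_tupleBall b p).inter_of_right T)
    dsimp only
    gcongr
  · refine div_le_one_of_le₀ ?_ (Nat.cast_nonneg _)
    exact Nat.cast_le.2 (Set.ncard_le_ncard Set.inter_subset_right (finite_tupleBall b p))

open Classical in
theorem exists_ncard_not_injective_lift_mul_le [Finite κ] [Finite σ] [Nontrivial σ]
    (b : FreeGroupBasis κ H) (hκ : 1 < Nat.card κ) :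
    ∃ C : ℕ, ∀ p : ℕ,
      (tupleBall b σ p \ {x | Function.Injective (FreeGroup.lift x)}).ncard * 2 ^ (p / 4) ≤
        C * (tupleBall b σ p).ncard := by
  have := Fintype.ofFinite κ
  have := Fintype.ofFinite σ
  rw [Nat.card_eq_fintype_card] at hκ
  refine ⟨4 * Fintype.card σ + 16 * Fintype.card σ ^ 2, fun p => ?_⟩
  let e : (σ → H) ≃ (σ → FreeGroup κ) := Equiv.piCongrRight fun _ => b.repr.toEquiv
  have hlift (x : σ → H) : Function.Injective (FreeGroup.lift (e x)) ↔
      Function.Injective (FreeGroup.lift x) := by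
    have : FreeGroup.lift (e x) = b.repr.toMonoidHom.comp (FreeGroup.lift x) := by
      ext i
      simp [e]
    rw [this]
    exact b.repr.injective.of_comp_iff (FreeGroup.lift x)
  have hball : tupleBall b σ p = e ⁻¹' FreeGroup.normBox κ σ p := by
    ext x
    simp only [tupleBall, wordLength, Set.mem_ofPred_eq, Set.mem_preimage, Finset.mem_coe,
      FreeGroup.mem_normBox]
    rfl
  have hbad : tupleBall b σ p \ {x | Function.Injective (FreeGroup.lift x)} =
      e ⁻¹' ((FreeGroup.normBox κ σ p).filter fun x =>
        ¬ Function.Injective (FreeGroup.lift x)) := by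
    ext x
    simp [hball, hlift]
  have hcard (s : Finset (σ → FreeGroup κ)) :
      (e ⁻¹' (s : Set (σ → FreeGroup κ))).ncard = s.card := by
    rw [Set.ncard_preimage_of_injective_subset_range e.injective (by simp), Set.ncard_coe_finset]
  rw [hbad, hball, hcard, hcard]
  -- `p / 4` is the largest `L` with `4 * L ≤ p`; the base 2 ≤ q already gives decay.
  refine le_trans ?_ (FreeGroup.card_not_injective_lift_mul_le hκ (L := p / 4) (by omega))
  gcongr
  omega

/-- A generic tuple of elements of a free group of rank at least `2` freely generates a free
subgroup. -/
theorem isGeneric_injective_lift [Finite κ] [Finite σ] [Nontrivial σ] (b : FreeGroupBasis κ H)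
    (hκ : 1 < Nat.card κ) :
    IsGeneric b {x : σ → H | Function.Injective (FreeGroup.lift x)} := by
  obtain ⟨C, hC⟩ := exists_ncard_not_injective_lift_mul_le (σ := σ) b hκ
  have hlim : Tendsto (fun p : ℕ => 1 - (C : ℝ) * (1 / 2) ^ (p / 4)) atTop (𝓝 1) := by
    have h := (tendsto_pow_atTop_nhds_zero_of_lt_one (r := (1 / 2 : ℝ)) (by norm_num)
      (by norm_num)).comp (Nat.tendsto_div_const_atTop (n := 4) (by norm_num))
    simpa using (h.const_mul (C : ℝ)).const_sub 1
  refine tendsto_of_tendsto_of_tendsto_of_le_of_le hlim tendsto_const_nhds (fun p => ?_)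
    fun p => ?_
  · have hpos : (0 : ℝ) < (tupleBall b σ p).ncard := by exact_mod_cast ncard_tupleBall_pos b p
    have hsum : ((tupleBall b σ p ∩ {x | Function.Injective (FreeGroup.lift x)}).ncard : ℝ) +
        (tupleBall b σ p \ {x | Function.Injective (FreeGroup.lift x)}).ncard =
          (tupleBall b σ p).ncard := by
      exact_mod_cast Set.ncard_inter_add_ncard_sdiff_eq_ncard _ _ (finite_tupleBall b p)
    have hle : ((tupleBall b σ p \ {x | Function.Injective (FreeGroup.lift x)}).ncard : ℝ) *
        2 ^ (p / 4) ≤ C * (tupleBall b σ p).ncard := by exact_mod_cast hC p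
    dsimp only
    rw [Set.inter_comm, le_div_iff₀ hpos, sub_mul, one_mul, sub_le_iff_le_add, ← hsum]
    rw [add_le_add_iff_left, hsum, one_div, inv_pow, mul_right_comm, ← div_eq_mul_inv,
      le_div_iff₀ (by positivity)]
    exact hle
  · refine div_le_one_of_le₀ ?_ (Nat.cast_nonneg _)
    exact Nat.cast_le.2 (Set.ncard_le_ncard Set.inter_subset_right (finite_tupleBall b p))

end Generic

/-- If the images of a basis under `φ` and `ψ` together with `u` and `v` freely generate a free
subgroup, then `u` and `v` are not doubly-twisted conjugate. -/
theorem doublyTwistedClass_ne_of_injective_lift {ι G H : Type*} [Group G] [Group H]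
    (a : FreeGroupBasis ι G) {φ ψ : G →* H} {u v : H}
    (h : Function.Injective (FreeGroup.lift (homPairTuple a (φ, ψ, u, v)))) :
    doublyTwistedClass φ ψ u ≠ doublyTwistedClass φ ψ v := by
  intro huv
  obtain ⟨g, hg⟩ : ∃ g : G, u = φ g * v * (ψ g)⁻¹ := Quotient.exact huv
  set x := homPairTuple a (φ, ψ, u, v) with hx
  have hφ : φ = ((FreeGroup.lift x).comp (FreeGroup.map Sum.inl)).comp a.repr.toMonoidHom :=
    a.ext_hom _ _ fun i => by simp [hx, homPairTuple]
  have hψ : ψ = ((FreeGroup.lift x).comp (FreeGroup.map (Sum.inr ∘ Sum.inl))).comp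
      a.repr.toMonoidHom :=
    a.ext_hom _ _ fun i => by simp [hx, homPairTuple]
  have hu : u = FreeGroup.lift x (FreeGroup.of (Sum.inr (Sum.inr 0))) := by
    simp [hx, homPairTuple]
  have hv : v = FreeGroup.lift x (FreeGroup.of (Sum.inr (Sum.inr 1))) := by
    simp [hx, homPairTuple]
  -- Both homomorphisms factor through `FreeGroup.lift x`, so injectivity pulls the equation in `H`
  -- back to the free group on the indices.
  have heq : (FreeGroup.of (Sum.inr (Sum.inr 0)) : FreeGroup (ι ⊕ ι ⊕ Fin 2)) =
      FreeGroup.map Sum.inl (a.repr g) * FreeGroup.of (Sum.inr (Sum.inr 1)) *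
        (FreeGroup.map (Sum.inr ∘ Sum.inl) (a.repr g))⁻¹ := by
    apply h
    rw [map_mul, map_mul, map_inv, ← hu, ← hv]
    conv_lhs => rw [hg]
    congr 2
    · exact DFunLike.congr_fun hφ g
    · exact DFunLike.congr_fun hψ g
  -- the exponent sum of the generator that is sent to `u`
  let w : ι ⊕ ι ⊕ Fin 2 → Multiplicative ℤ :=
    Sum.elim 1 (Sum.elim 1 ![Multiplicative.ofAdd 1, 1])
  have hw₁ : (FreeGroup.lift w).comp (FreeGroup.map Sum.inl) = 1 := by
    ext i
    simp [w]
  have hw₂ : (FreeGroup.lift w).comp (FreeGroup.map (Sum.inr ∘ Sum.inl)) = 1 := by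
    ext i
    simp [w]
  have h₁ := DFunLike.congr_fun hw₁ (a.repr g)
  have h₂ := DFunLike.congr_fun hw₂ (a.repr g)
  have := congr_arg (FreeGroup.lift w) heq
  simp only [MonoidHom.comp_apply, MonoidHom.one_apply] at h₁ h₂
  rw [map_mul, map_mul, map_inv, h₁, h₂] at this
  simp [w] at this

theorem mainTheorem1 {ι κ G H : Type*} [Finite ι] [Finite κ] [Group G] [Group H]
    (a : FreeGroupBasis ι G) (b : FreeGroupBasis κ H) (hH : 1 < Nat.card κ) :
    IsGeneric b (homPairTuple a ''
      {x : (G →* H) × (G →* H) × H × H |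
        doublyTwistedClass x.1 x.2.1 x.2.2.1 ≠ doublyTwistedClass x.1 x.2.1 x.2.2.2}) := by
  -- The positions of u and v are two distinct indices, even when `ι` is empty.
  have : Nontrivial (ι ⊕ ι ⊕ Fin 2) :=
    ⟨Sum.inr (Sum.inr 0), Sum.inr (Sum.inr 1), by simp⟩
  refine (isGeneric_injective_lift b hH).mono fun y hy => ?_
  obtain ⟨x, rfl⟩ := (homPairTuple a).surjective y
  exact ⟨x, doublyTwistedClass_ne_of_injective_lift a hy, rfl⟩
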